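/- Let $\mathcal H$ and $\mathcal G$ be real Hilbert spaces, let $f\colon\mathcal H\to\left]-\infty,+\infty\right]$ and $g\colon\mathcal G\to\left]-\infty,+\infty\right]$ be proper lower semicontinuous convex functions, and let $L\colon\mathcal H\to\mathcal G$ be a nonzero bounded linear operator with adjoint $L^*$. Suppose that $0\in\operatorname{ran}(\partial f+L^*\circ\partial g\circ L)$, i.e., that there is $x\in\mathcal H$ with $0\in\partial f(x)+L^*(\partial g(Lx))$. Consider the primal problem \[ \underset{x\in\mathcal H}{\text{minimize}}\;\; f(x)+g(Lx)\qquad(\mathrm P) \] and the dual problem \[ \underset{v\in\mathcal G}{\text{minimize}}\;\; f^*(-L^*v)+g^*(v),\qquad(\mathrm D) \] where $f^*\colon u\mapsto\sup_{x}(\langle x,u\rangle-f(x))$ is the conjugate of $f$, and likewise $g^*$. For a proper lower semicontinuous convex function $h$, $\operatorname{prox}_h x$ denotes the unique minimizer of $y\mapsto h(y)+\frac12\|x-y\|^2$. Let $\varepsilon>0$, let $(\gamma_n)_{n\in\mathbb N}$ be real numbers such that \[ \varepsilon\leq\gamma_n\leq\frac{1-\varepsilon}{\sqrt{1+\|L\|^2}}\qquad\text{for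 every } n\in\mathbb N, \] let $(x_0,y_0,v_0)\in\mathcal H\times\mathcal G\times\mathcal G$ be arbitrary, and iterate, for $n=0,1,\dots$, \begin{align*} r_n&=\gamma_n(Lx_n-y_n),\\ p_n&=\operatorname{prox}_{\gamma_n f}(x_n-\gamma_nL^*v_n),\\ q_n&=\operatorname{prox}_{\gamma_n g}(y_n+\gamma_nv_n),\\ x_{n+1}&=p_n-\gamma_nL^*r_n,\\ y_{n+1}&=q_n+\gamma_nr_n,\\ v_{n+1}&=v_n+\gamma_n(Lp_n-q_n). \end{align*} Then $(x_n)_{n\in\mathbb N}$ converges weakly to a solution of $(\mathrm P)$ and $(v_n)_{n\in\mathbb N}$ converges weakly to a solution of $(\mathrm D)$. -/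

import Mathlib

open Filter Topology
open scoped Pointwise InnerProductSpace

namespace ConvexDuality

variable {E : Type*} [NormedAddCommGroup E] [InnerProductSpace ℝ E]

/-- The class `Γ₀(E)` of proper lower semicontinuous convex functions from `E` to `]-∞, +∞]`,
seen as extended-real-valued functions that never take the value `-∞`. -/
structure IsGammaZero (f : E → EReal) : Prop where
  ne_bot : ∀ x, f x ≠ ⊥
  exists_ne_top : ∃ x, f x ≠ ⊤
  lowerSemicontinuous : LowerSemicontinuous f
  convex : ∀ x y : E, ∀ a b : ℝ, 0 < a → 0 < b → a + b = 1 →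
    f (a • x + b • y) ≤ (a : EReal) * f x + (b : EReal) * f y

/-- The subdifferential `∂f`, as a set-valued operator. -/
def subdifferential (f : E → EReal) (x : E) : Set E :=
  {u | ∀ y, ((⟪y - x, u⟫_ℝ : ℝ) : EReal) + f x ≤ f y}

/-- The conjugate `f^*`. -/
noncomputable def conjugate (f : E → EReal) (u : E) : EReal :=
  ⨆ x, ((⟪x, u⟫_ℝ : ℝ) : EReal) - f x

/-- The set of global minimizers of `F`. -/
def argminSet (F : E → EReal) : Set E :=
  {x | ∀ y, F x ≤ F y}

open Classical in
/-- The unique global minimizer of `F` when there is exactly one (and `0` by convention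
otherwise). -/
noncomputable def argmin (F : E → EReal) : E :=
  if h : ∃! x, x ∈ argminSet F then h.choose else 0

/-- The proximity operator of `f`: `prox f x` is the minimizer of `f + ‖x - ·‖² / 2`. -/
noncomputable def prox (f : E → EReal) (x : E) : E :=
  argmin fun y => f y + ((1 / 2 * ‖x - y‖ ^ 2 : ℝ) : EReal)

/-- The function `γ f`, for a real number `γ` (only used with `γ > 0`). -/
noncomputable def scale (γ : ℝ) (f : E → EReal) (x : E) : EReal :=
  (γ : EReal) * f x

/-- Weak convergence of the sequence `x` to `a`. -/
def WeaklyConvergesTo (x : ℕ → E) (a : E) : Prop :=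
  Tendsto (fun n => toWeakSpace ℝ E (x n)) atTop (𝓝 (toWeakSpace ℝ E a))

variable {H G : Type*} [NormedAddCommGroup H] [InnerProductSpace ℝ H] [CompleteSpace H]
  [NormedAddCommGroup G] [InnerProductSpace ℝ G] [CompleteSpace G]

/-- The primal objective `x ↦ f(x) + g(Lx)`. -/
noncomputable def primalObjective (f : H → EReal) (g : G → EReal) (L : H →L[ℝ] G) (x : H) : EReal :=
  f x + g (L x)

/-- The dual objective `v ↦ f^*(-L^*v) + g^*(v)`. -/
noncomputable def dualObjective (f : H → EReal) (g : G → EReal) (L : H →L[ℝ] G) (v : G) : EReal :=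
  conjugate f (-(L.adjoint v)) + conjugate g v

/-- The set-valued operator `∂f + L^* ∘ ∂g ∘ L`. -/
noncomputable def primalOperator (f : H → EReal) (g : G → EReal) (L : H →L[ℝ] G) (x : H) : Set H :=
  subdifferential f x + L.adjoint '' subdifferential g (L x)

/-- The range of a set-valued operator. -/
def setValuedRange (A : H → Set H) : Set H :=
  {u | ∃ x, u ∈ A x}

end ConvexDuality

open ConvexDuality

/-! A pair (x, v) with -L^*v ∈ ∂f(x) and v ∈ ∂g(Lx) solves both problems, and the range condition
supplies one. With z standing for Lx, such pairs are the zeros of the sum of the operator (∂f, ∂g,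
0) and the skew operator (x, z, v) ↦ (L^*v, -v, z - Lx), of norm at most √(1 + ‖L‖²). The iteration
is Tseng's forward-backward-forward method for this sum.

Monotonicity and the step-size bound make the squared distance to every saddle point decrease by at
least a fixed multiple of the squared residuals (`IsSaddle.lyapunov_step`). Hence the iterates are
bounded and the residuals vanish. Weak lower semicontinuity then turns every weak cluster point into
a saddle point (`isSaddle_of_isWeakLimit`), and Opial's argument leaves only one cluster point
(`exists_isWeakLimit_of_lyapunov`). Ultrafilters play the role of subsequences. -/

namespace ConvexDuality

/-! ### Proximal points of real-valued convex functions -/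

section RealProx

variable {E : Type*} [NormedAddCommGroup E] [InnerProductSpace ℝ E]

/-- A convex function with closed sublevel sets decreases at most linearly. -/
theorem exists_linear_lower_bound {D : Set E} {φ : E → ℝ} (hφ : ConvexOn ℝ D φ)
    (hcl : ∀ c, IsClosed {x | x ∈ D ∧ φ x ≤ c}) {a : E} (ha : a ∈ D) :
    ∃ C : ℝ, ∀ y ∈ D, φ a - 1 - C * ‖y - a‖ ≤ φ y := by
  have hopen : {x | x ∈ D ∧ φ x ≤ φ a - 1}ᶜ ∈ 𝓝 a :=
    (hcl _).isOpen_compl.mem_nhds (by simp)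
  obtain ⟨δ, hδ, hball⟩ := Metric.mem_nhds_iff.1 hopen
  -- For distant `y`, the point of the segment from `a` to `y` at distance δ/2 from `a` still has
  -- value above φ(a) - 1; convexity extrapolates this to `y`.
  refine ⟨2 / δ, fun y hy => ?_⟩
  have hnear : ∀ z ∈ D, ‖z - a‖ < δ → φ a - 1 < φ z := by
    intro z hz hzδ
    by_contra! h
    exact hball (by simpa [dist_eq_norm] using hzδ) ⟨hz, h⟩
  rcases lt_or_ge ‖y - a‖ δ with h | h
  · have := hnear y hy h
    have : 0 ≤ 2 / δ * ‖y - a‖ := by positivity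
    linarith
  · set d := ‖y - a‖
    have hd : 0 < d := hδ.trans_le h
    set t := δ / (2 * d)
    have ht : 0 < t := by positivity
    have ht1 : t ≤ 1 := by
      rw [div_le_one (by positivity)]; linarith
    have hmem : (1 - t) • a + t • y ∈ D :=
      hφ.1 ha hy (by linarith) ht.le (by ring)
    have hval := hφ.2 ha hy (by linarith : 0 ≤ 1 - t) ht.le (by ring)
    have hlow := hnear _ hmem (by
      have : (1 - t) • a + t • y - a = t • (y - a) := by module
      rw [this, norm_smul, Real.norm_of_nonneg ht.le]
      change δ / (2 * d) * d < δ
      field_simp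
      linarith)
    simp only [smul_eq_mul] at hval
    have h1 : t * (φ a - φ y) < 1 := by nlinarith
    have h2 : 2 / δ * d = 1 / t := by simp only [t]; field_simp
    have h3 : φ a - φ y < 1 / t := by
      rw [lt_div_iff₀ ht]; linarith
    rw [h2]; linarith

/-- Midpoint estimate for the strongly convex function `φ + ‖x - ·‖² / 2`. -/
theorem norm_sub_sq_le_of_le_midpoint {D : Set E} {φ : E → ℝ} (hφ : ConvexOn ℝ D φ) (x : E) {m : ℝ}
    (hm : ∀ y ∈ D, m ≤ φ y + 1 / 2 * ‖x - y‖ ^ 2) {y z : E} (hy : y ∈ D) (hz : z ∈ D) :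
    ‖y - z‖ ^ 2 ≤ 4 * ((φ y + 1 / 2 * ‖x - y‖ ^ 2 - m) + (φ z + 1 / 2 * ‖x - z‖ ^ 2 - m)) := by
  have hmid : (1 / 2 : ℝ) • y + (1 / 2 : ℝ) • z ∈ D :=
    hφ.1 hy hz (by norm_num) (by norm_num) (by norm_num)
  have hval := hφ.2 hy hz (by norm_num : (0 : ℝ) ≤ 1 / 2) (by norm_num : (0 : ℝ) ≤ 1 / 2)
    (by norm_num)
  have hlow := hm _ hmid
  simp only [smul_eq_mul] at hval
  have hpar := parallelogram_law_with_norm ℝ (x - y) (x - z)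
  have e1 : x - y + (x - z) = (2 : ℝ) • (x - ((1 / 2 : ℝ) • y + (1 / 2 : ℝ) • z)) := by module
  have e2 : x - y - (x - z) = z - y := by abel
  rw [e1, e2, norm_smul, norm_sub_rev z y, Real.norm_of_nonneg (by norm_num : (0 : ℝ) ≤ 2)] at hpar
  nlinarith

/-- Existence of the proximal point together with its variational characterization. -/
theorem exists_proximal_point [CompleteSpace E] {D : Set E} {φ : E → ℝ} (hφ : ConvexOn ℝ D φ)
    (hcl : ∀ c, IsClosed {x | x ∈ D ∧ φ x ≤ c}) (hD : D.Nonempty) (x : E) :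
    ∃ p ∈ D, ∀ y ∈ D, ⟪y - p, x - p⟫_ℝ + φ p ≤ φ y := by
  obtain ⟨a, ha⟩ := hD
  obtain ⟨C, hC⟩ := exists_linear_lower_bound hφ hcl ha
  set F : E → ℝ := fun y => φ y + 1 / 2 * ‖x - y‖ ^ 2 with hF
  have hbdd : BddBelow (F '' D) := by
    -- The quadratic term absorbs the linear loss: s²/2 - |C|s ≥ -C²/2 with s = ‖x - y‖.
    refine ⟨φ a - 1 - |C| * ‖x - a‖ - C ^ 2 / 2, ?_⟩
    rintro _ ⟨y, hy, rfl⟩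
    have h1 := hC y hy
    have h2 : ‖y - a‖ ≤ ‖x - y‖ + ‖x - a‖ := by
      rw [norm_sub_rev x y]
      simpa using norm_sub_le_norm_sub_add_norm_sub y x a
    have h3 : C * ‖y - a‖ ≤ |C| * (‖x - y‖ + ‖x - a‖) :=
      mul_le_mul (le_abs_self C) h2 (norm_nonneg _) (abs_nonneg _)
    simp only [hF]
    nlinarith [sq_nonneg (‖x - y‖ - |C|), sq_abs C]
  set m := sInf (F '' D)
  have hm : ∀ y ∈ D, m ≤ F y := fun y hy => csInf_le hbdd ⟨y, hy, rfl⟩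
  have hex : ∀ n : ℕ, ∃ y ∈ D, F y < m + 1 / ((n : ℝ) + 1) := by
    intro n
    obtain ⟨_, ⟨y, hy, rfl⟩, h⟩ := exists_lt_of_csInf_lt (⟨F a, a, ha, rfl⟩ : (F '' D).Nonempty)
      (lt_add_of_pos_right m (by positivity : (0 : ℝ) < 1 / ((n : ℝ) + 1)))
    exact ⟨y, hy, h⟩
  choose u hu hFu using hex
  have hFlim : Tendsto (fun n => F (u n)) atTop (𝓝 m) := by
    refine tendsto_of_tendsto_of_tendsto_of_le_of_le tendsto_const_nhds ?_
      (fun n => hm _ (hu n)) (fun n => (hFu n).le)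
    simpa using tendsto_const_nhds.add (tendsto_one_div_add_atTop_nhds_zero_nat (𝕜 := ℝ))
  have hcau : CauchySeq u := by
    rw [Metric.cauchySeq_iff]
    intro ε hε
    have hev := hFlim.eventually_lt_const (lt_add_of_pos_right m (by positivity : 0 < ε ^ 2 / 8))
    obtain ⟨N, hN⟩ := eventually_atTop.1 hev
    refine ⟨N, fun k hk l hl => ?_⟩
    have h := norm_sub_sq_le_of_le_midpoint hφ x hm (hu k) (hu l)
    have h1 := hN k hk
    have h2 := hN l hl
    simp only [hF] at h1 h2
    rw [dist_eq_norm]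
    exact lt_of_pow_lt_pow_left₀ 2 hε.le (by linarith)
  obtain ⟨p, hp⟩ := cauchySeq_tendsto_of_complete hcau
  have hφlim : Tendsto (fun n => φ (u n)) atTop (𝓝 (m - 1 / 2 * ‖x - p‖ ^ 2)) := by
    have h := hFlim.sub (((tendsto_const_nhds (x := x)).sub hp).norm.pow 2 |>.const_mul (1 / 2))
    simpa [hF] using h
  -- The slack `δ` puts the tail of the minimizing sequence in one closed sublevel set.
  have hkey : ∀ δ > 0, p ∈ D ∧ φ p ≤ m - 1 / 2 * ‖x - p‖ ^ 2 + δ := by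
    intro δ hδ
    refine (hcl _).mem_of_tendsto hp ?_
    filter_upwards [hφlim.eventually_lt_const (lt_add_of_pos_right _ hδ)] with n hn
    exact ⟨hu n, hn.le⟩
  have hpD : p ∈ D := (hkey 1 one_pos).1
  have hpm : φ p ≤ m - 1 / 2 * ‖x - p‖ ^ 2 := le_of_forall_pos_le_add fun δ hδ => (hkey δ hδ).2
  refine ⟨p, hpD, fun y hy => ?_⟩
  -- First-order optimality: compare `p` with (1 - t)p + ty, divide by t, let t → 0⁺.
  have hlim : Tendsto (fun t : ℝ => φ y - φ p - ⟪y - p, x - p⟫_ℝ + t / 2 * ‖y - p‖ ^ 2) (𝓝[>] 0)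
      (𝓝 (φ y - φ p - ⟪y - p, x - p⟫_ℝ + 0 / 2 * ‖y - p‖ ^ 2)) :=
    (Continuous.tendsto (by fun_prop) 0).mono_left nhdsWithin_le_nhds
  have hnonneg : 0 ≤ φ y - φ p - ⟪y - p, x - p⟫_ℝ + 0 / 2 * ‖y - p‖ ^ 2 := by
    refine ge_of_tendsto hlim ?_
    filter_upwards [Ioo_mem_nhdsGT (zero_lt_one' ℝ)] with t ht
    have hmem : (1 - t) • p + t • y ∈ D := hφ.1 hpD hy (by linarith [ht.2]) ht.1.le (by ring)
    have hval := hφ.2 hpD hy (by linarith [ht.2] : 0 ≤ 1 - t) ht.1.le (by ring)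
    have hlow := hm _ hmem
    have e : x - ((1 - t) • p + t • y) = (x - p) - t • (y - p) := by module
    simp only [hF, smul_eq_mul] at hval hlow
    rw [e, norm_sub_sq_real, norm_smul, inner_smul_right, real_inner_comm,
      Real.norm_of_nonneg ht.1.le] at hlow
    have : 0 ≤ t * (φ y - φ p - ⟪y - p, x - p⟫_ℝ + t / 2 * ‖y - p‖ ^ 2) := by nlinarith
    exact nonneg_of_mul_nonneg_right this ht.1
  linarith

end RealProx

/-! ### Passage from extended-real to real values, and the proximity operator -/

section GammaZero

variable {E : Type*} [NormedAddCommGroup E] [InnerProductSpace ℝ E] {f : E → EReal}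

theorem IsGammaZero.coe_toReal (hf : IsGammaZero f) {x : E} (hx : f x ≠ ⊤) :
    ((f x).toReal : EReal) = f x :=
  EReal.coe_toReal hx (hf.ne_bot x)

theorem IsGammaZero.convexOn (hf : IsGammaZero f) :
    ConvexOn ℝ {x | f x ≠ ⊤} fun x => (f x).toReal := by
  have key : ∀ x ∈ {x | f x ≠ ⊤}, ∀ y ∈ {x | f x ≠ ⊤}, ∀ a b : ℝ, 0 < a → 0 < b → a + b = 1 →
      f (a • x + b • y) ≤ ((a * (f x).toReal + b * (f y).toReal : ℝ) : EReal) := by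
    intro x hx y hy a b ha hb hab
    have h := hf.convex x y a b ha hb hab
    rw [← hf.coe_toReal hx, ← hf.coe_toReal hy] at h
    exact_mod_cast h
  have hconv : Convex ℝ {x | f x ≠ ⊤} := by
    rw [convex_iff_forall_pos]
    intro x hx y hy a b ha hb hab
    exact ((key x hx y hy a b ha hb hab).trans_lt (EReal.coe_lt_top _)).ne
  rw [convexOn_iff_forall_pos]
  refine ⟨hconv, fun x hx y hy a b ha hb hab => ?_⟩
  have h := key x hx y hy a b ha hb hab
  rw [← hf.coe_toReal (hconv hx hy ha.le hb.le hab)] at h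
  exact_mod_cast h

theorem IsGammaZero.setOf_toReal_le (hf : IsGammaZero f) (c : ℝ) :
    {x | x ∈ {x | f x ≠ ⊤} ∧ (f x).toReal ≤ c} = {x | f x ≤ c} := by
  ext x
  constructor
  · rintro ⟨hx, h⟩
    change f x ≤ c
    rw [← hf.coe_toReal hx]
    exact_mod_cast h
  · intro h
    have hx : f x ≠ ⊤ := (lt_of_le_of_lt h (EReal.coe_lt_top c)).ne
    refine ⟨hx, ?_⟩
    change f x ≤ c at h
    rw [← hf.coe_toReal hx] at h
    exact_mod_cast h

theorem IsGammaZero.isClosed_sublevel (hf : IsGammaZero f) (c : ℝ) : IsClosed {x | f x ≤ c} :=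
  hf.lowerSemicontinuous.isClosed_preimage c

theorem IsGammaZero.convex_sublevel (hf : IsGammaZero f) (c : ℝ) : Convex ℝ {x | f x ≤ c} :=
  hf.setOf_toReal_le c ▸ hf.convexOn.convex_le c

theorem argmin_eq_of_unique {E : Type*} [NormedAddCommGroup E] {F : E → EReal} {p : E} (hp : p ∈ argminSet F)
    (huniq : ∀ y ∈ argminSet F, y = p) : argmin F = p := by
  have h : ∃! x, x ∈ argminSet F := ⟨p, hp, huniq⟩
  rw [argmin, dif_pos h]
  exact huniq _ h.choose_spec.1

/-- The proximal point `p` of `γ f` at `x` satisfies `(x - p) / γ ∈ ∂f(p)`. -/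
theorem IsGammaZero.prox_scale_spec [CompleteSpace E] (hf : IsGammaZero f) {γ : ℝ} (hγ : 0 < γ)
    (x : E) :
    f (prox (scale γ f) x) ≠ ⊤ ∧ ∀ y, f y ≠ ⊤ →
      ⟪y - prox (scale γ f) x, γ⁻¹ • (x - prox (scale γ f) x)⟫_ℝ
        + (f (prox (scale γ f) x)).toReal ≤ (f y).toReal := by
  have hcl : ∀ c, IsClosed {x | x ∈ {x | f x ≠ ⊤} ∧ γ • (f x).toReal ≤ c} := by
    intro c
    have : {x | x ∈ {x | f x ≠ ⊤} ∧ γ • (f x).toReal ≤ c} =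
        {x | x ∈ {x | f x ≠ ⊤} ∧ (f x).toReal ≤ c / γ} := by
      ext x
      simp only [Set.mem_ofPred_eq, smul_eq_mul, le_div_iff₀' hγ]
    rw [this, hf.setOf_toReal_le]
    exact hf.isClosed_sublevel _
  obtain ⟨p, hp, hvar⟩ := exists_proximal_point (hf.convexOn.smul hγ.le) hcl hf.exists_ne_top x
  simp only [smul_eq_mul, Set.mem_ofPred_eq] at hp hvar
  have htop : ∀ y, f y = ⊤ →
      scale γ f y + ((1 / 2 * ‖x - y‖ ^ 2 : ℝ) : EReal) = ⊤ := by
    intro y hy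
    rw [scale, hy, EReal.coe_mul_top_of_pos hγ, EReal.top_add_coe]
  have hcoe : ∀ y, f y ≠ ⊤ → scale γ f y + ((1 / 2 * ‖x - y‖ ^ 2 : ℝ) : EReal) =
      ((γ * (f y).toReal + 1 / 2 * ‖x - y‖ ^ 2 : ℝ) : EReal) := by
    intro y hy
    rw [scale, ← hf.coe_toReal hy]
    simp only [EReal.toReal_coe]
    push_cast
    rfl
  -- Quadratic growth around `p` makes the minimizer unique, so `argmin` does not take its default
  -- value 0.
  have hgrow : ∀ y, f y ≠ ⊤ → γ * (f p).toReal + 1 / 2 * ‖x - p‖ ^ 2 + 1 / 2 * ‖y - p‖ ^ 2 ≤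
      γ * (f y).toReal + 1 / 2 * ‖x - y‖ ^ 2 := by
    intro y hy
    have h := hvar y hy
    have e : x - y = (x - p) - (y - p) := by abel
    rw [e, norm_sub_sq_real (x - p), real_inner_comm]
    linarith
  have heq : prox (scale γ f) x = p := by
    refine argmin_eq_of_unique (fun y => ?_) fun y hy => ?_
    · by_cases hy : f y = ⊤
      · simp only [htop y hy, le_top]
      · simp only [hcoe y hy, hcoe p hp]
        exact_mod_cast (by nlinarith [hgrow y hy, sq_nonneg ‖y - p‖] :
          γ * (f p).toReal + 1 / 2 * ‖x - p‖ ^ 2 ≤ γ * (f y).toReal + 1 / 2 * ‖x - y‖ ^ 2)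
    · have h := hy p
      by_cases hyt : f y = ⊤
      · simp only [htop y hyt, hcoe p hp] at h
        exact absurd h (not_le.2 (EReal.coe_lt_top _))
      · simp only [hcoe y hyt, hcoe p hp] at h
        have h' : γ * (f y).toReal + 1 / 2 * ‖x - y‖ ^ 2 ≤
          γ * (f p).toReal + 1 / 2 * ‖x - p‖ ^ 2 := by exact_mod_cast h
        have : ‖y - p‖ ^ 2 ≤ 0 := by linarith [hgrow y hyt]
        exact sub_eq_zero.1 (norm_eq_zero.1 (pow_eq_zero_iff two_ne_zero |>.1
          (le_antisymm this (sq_nonneg _))))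
  rw [heq]
  refine ⟨hp, fun y hy => ?_⟩
  have h := hvar y hy
  rw [inner_smul_right]
  have e : γ⁻¹ * ⟪y - p, x - p⟫_ℝ + (f p).toReal =
      γ⁻¹ * (⟪y - p, x - p⟫_ℝ + γ * (f p).toReal) := by field_simp
  rw [e, inv_mul_le_iff₀ hγ]
  exact h

end GammaZero

/-! ### Weak limits along filters -/

section WeakLimits

variable {ι E : Type*} [NormedAddCommGroup E] [InnerProductSpace ℝ E]

/-- `a` is the weak limit of `x` along the filter `l`, expressed through inner products. -/
def IsWeakLimit (l : Filter ι) (x : ι → E) (a : E) : Prop :=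
  ∀ u, Tendsto (fun i => ⟪x i, u⟫_ℝ) l (𝓝 ⟪a, u⟫_ℝ)

theorem weaklyConvergesTo_of_isWeakLimit [CompleteSpace E] {x : ℕ → E} {a : E}
    (h : IsWeakLimit atTop x a) : WeaklyConvergesTo x a := by
  have hinj : Function.Injective (topDualPairing ℝ E).flip := fun b c hbc =>
    ext_inner_left ℝ fun u => by
      simpa using LinearMap.congr_fun hbc (InnerProductSpace.toDual ℝ E u)
  refine (WeakBilin.tendsto_iff_forall_eval_tendsto _ hinj).2 fun F => ?_
  have e : ∀ z, F z = ⟪z, (InnerProductSpace.toDual ℝ E).symm F⟫_ℝ := fun z => by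
    rw [real_inner_comm, InnerProductSpace.toDual_symm_apply]
  change Tendsto (fun n => F (x n)) atTop (𝓝 (F a))
  simpa only [e] using h ((InnerProductSpace.toDual ℝ E).symm F)

theorem isWeakLimit_of_tendsto {l : Filter ι} {x : ι → E} {a : E} (h : Tendsto x l (𝓝 a)) :
    IsWeakLimit l x a :=
  fun _ => h.inner tendsto_const_nhds

theorem IsWeakLimit.sub {l : Filter ι} {x y : ι → E} {a b : E} (hx : IsWeakLimit l x a)
    (hy : IsWeakLimit l y b) : IsWeakLimit l (fun i => x i - y i) (a - b) := fun u => by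
  simpa only [inner_sub_left] using (hx u).sub (hy u)

theorem IsWeakLimit.map {F : Type*} [NormedAddCommGroup F] [InnerProductSpace ℝ F]
    [CompleteSpace E] [CompleteSpace F] {l : Filter ι} {x : ι → E} {a : E}
    (h : IsWeakLimit l x a) (L : E →L[ℝ] F) : IsWeakLimit l (fun i => L (x i)) (L a) := fun u => by
  simpa only [ContinuousLinearMap.adjoint_inner_right] using h (L.adjoint u)

/-- Bounded families in a Hilbert space have weak limits along ultrafilters. -/
theorem exists_isWeakLimit [CompleteSpace E] (U : Ultrafilter ι) {x : ι → E} {C : ℝ}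
    (hx : ∀ i, ‖x i‖ ≤ C) : ∃ a, IsWeakLimit (U : Filter ι) x a := by
  have hbd : ∀ u i, |⟪x i, u⟫_ℝ| ≤ C * ‖u‖ := fun u i =>
    (abs_real_inner_le_norm _ _).trans (mul_le_mul_of_nonneg_right (hx i) (norm_nonneg u))
  have hlim : ∀ u, ∃ t, Tendsto (fun i => ⟪x i, u⟫_ℝ) (U : Filter ι) (𝓝 t) := by
    intro u
    obtain ⟨t, -, ht⟩ := (isCompact_Icc (a := -(C * ‖u‖)) (b := C * ‖u‖)).ultrafilter_le_nhds'
      (U.map fun i => ⟪x i, u⟫_ℝ)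
      (Filter.mem_map.2 (Filter.univ_mem' fun i => abs_le.1 (hbd u i)))
    exact ⟨t, ht⟩
  choose φ hφ using hlim
  -- The pointwise limits form a bounded linear functional; Riesz representation gives the weak
  -- limit.
  let ψ : E →ₗ[ℝ] ℝ :=
    { toFun := φ
      map_add' := fun u w => tendsto_nhds_unique (hφ (u + w)) (by
        simpa only [inner_add_right] using (hφ u).add (hφ w))
      map_smul' := fun c u => tendsto_nhds_unique (hφ (c • u)) (by
        simpa only [inner_smul_right, smul_eq_mul, RingHom.id_apply] using (hφ u).const_mul c) }
  let Ψ : StrongDual ℝ E := ψ.mkContinuous C fun u =>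
    le_of_tendsto (hφ u).norm (Filter.univ_mem' fun i => hbd u i)
  refine ⟨(InnerProductSpace.toDual ℝ E).symm Ψ, fun u => ?_⟩
  rw [InnerProductSpace.toDual_symm_apply]
  exact hφ u

/-- Mazur's argument: a functional strictly separating `a` from `s` contradicts weak convergence.
Visiting `s` frequently suffices, which suits proofs by contradiction. -/
theorem IsWeakLimit.mem_of_convex_of_isClosed [CompleteSpace E] {l : Filter ι} {x : ι → E} {a : E}
    (h : IsWeakLimit l x a) {s : Set E} (hs : Convex ℝ s) (hs' : IsClosed s)
    (hx : ∃ᶠ i in l, x i ∈ s) : a ∈ s := by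
  by_contra ha
  obtain ⟨F, u, hFa, hF⟩ := geometric_hahn_banach_point_closed hs hs' ha
  have e : ∀ z, F z = ⟪z, (InnerProductSpace.toDual ℝ E).symm F⟫_ℝ := fun z => by
    rw [real_inner_comm, InnerProductSpace.toDual_symm_apply]
  rw [e] at hFa
  obtain ⟨i, hi, hi'⟩ := (hx.and_eventually ((h _).eventually_lt_const hFa)).exists
  have := hF _ hi
  rw [e] at this
  exact lt_asymm this hi'

/-- Functions in `Γ₀` are weakly lower semicontinuous. -/
theorem IsGammaZero.eventually_lt_of_isWeakLimit [CompleteSpace E] {f : E → EReal}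
    (hf : IsGammaZero f) {l : Filter ι} {x : ι → E} {a : E} (h : IsWeakLimit l x a) {c : EReal}
    (hc : c < f a) : ∀ᶠ i in l, c < f (x i) := by
  induction c with
  | bot => exact Eventually.of_forall fun i => bot_lt_iff_ne_bot.2 (hf.ne_bot _)
  | top => exact absurd hc not_top_lt
  | coe c =>
    by_contra hcon
    refine not_le.2 hc (h.mem_of_convex_of_isClosed (hf.convex_sublevel c) (hf.isClosed_sublevel c)
      ((not_eventually.1 hcon).mono fun i hi => not_lt.1 hi))

theorem tendsto_inner_zero_of_bounded {l : Filter ι} {b d : ι → E} {C : ℝ} (hb : ∀ i, ‖b i‖ ≤ C)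
    (hd : Tendsto d l (𝓝 0)) : Tendsto (fun i => ⟪b i, d i⟫_ℝ) l (𝓝 0) := by
  refine squeeze_zero_norm (a := fun i => C * ‖d i‖) (fun i => ?_) ?_
  · exact (norm_inner_le_norm _ _).trans (mul_le_mul_of_nonneg_right (hb i) (norm_nonneg _))
  · simpa using hd.norm.const_mul C

end WeakLimits

/-! ### Saddle points and duality -/

section Saddle

variable {H G : Type*} [NormedAddCommGroup H] [InnerProductSpace ℝ H] [CompleteSpace H]
  [NormedAddCommGroup G] [InnerProductSpace ℝ G] [CompleteSpace G]

/-- `(x, v)` satisfies `-L^* v ∈ ∂f(x)` and `v ∈ ∂g(Lx)`, in aggregated form: `(x, Lx)` minimizes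
the Lagrangian `(y, z) ↦ f(y) + g(z) + ⟪Ly - z, v⟫`. -/
structure IsSaddle {H G : Type*} [NormedAddCommGroup H] [InnerProductSpace ℝ H]
    [NormedAddCommGroup G] [InnerProductSpace ℝ G] (f : H → EReal) (g : G → EReal) (L : H →L[ℝ] G) (x : H) (v : G) : Prop where
  left_ne_top : f x ≠ ⊤
  right_ne_top : g (L x) ≠ ⊤
  le : ∀ y z, f y ≠ ⊤ → g z ≠ ⊤ →
    (f x).toReal + (g (L x)).toReal + ⟪z - L y, v⟫_ℝ ≤ (f y).toReal + (g z).toReal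

variable {f : H → EReal} {g : G → EReal} {L : H →L[ℝ] G}

theorem ne_top_of_mem_subdifferential {E : Type*} [NormedAddCommGroup E] [InnerProductSpace ℝ E]
    {h : E → EReal} (hh : IsGammaZero h) {x u : E} (hu : u ∈ subdifferential h x) : h x ≠ ⊤ := by
  intro hx
  obtain ⟨y, hy⟩ := hh.exists_ne_top
  have := hu y
  rw [hx, EReal.coe_add_top] at this
  exact hy (top_le_iff.1 this)

theorem toReal_le_of_mem_subdifferential {E : Type*} [NormedAddCommGroup E] [InnerProductSpace ℝ E]
    {h : E → EReal} (hh : IsGammaZero h) {x u : E} (hu : u ∈ subdifferential h x) {y : E}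
    (hy : h y ≠ ⊤) : ⟪y - x, u⟫_ℝ + (h x).toReal ≤ (h y).toReal := by
  have := hu y
  rw [← hh.coe_toReal (ne_top_of_mem_subdifferential hh hu), ← hh.coe_toReal hy] at this
  exact_mod_cast this

/-- Sum of the two subgradient inequalities, with -L^*v as the subgradient of `f`. -/
theorem exists_isSaddle (hf : IsGammaZero f) (hg : IsGammaZero g)
    (hran : (0 : H) ∈ setValuedRange (primalOperator f g L)) : ∃ x v, IsSaddle f g L x v := by
  obtain ⟨x, hx⟩ := hran
  obtain ⟨u, hu, _, ⟨v, hv, rfl⟩, huv⟩ := Set.mem_add.1 hx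
  refine ⟨x, v, ne_top_of_mem_subdifferential hf hu, ne_top_of_mem_subdifferential hg hv,
    fun y z hy hz => ?_⟩
  have h1 := toReal_le_of_mem_subdifferential hf hu hy
  have h2 := toReal_le_of_mem_subdifferential hg hv hz
  rw [eq_neg_of_add_eq_zero_left huv, inner_neg_right, ContinuousLinearMap.adjoint_inner_right,
    map_sub] at h1
  simp only [inner_sub_left] at *
  linarith

theorem IsSaddle.mem_argminSet_primal {H G : Type*} [NormedAddCommGroup H]
    [InnerProductSpace ℝ H] [NormedAddCommGroup G] [InnerProductSpace ℝ G] {f : H → EReal}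
    {g : G → EReal} {L : H →L[ℝ] G} (hf : IsGammaZero f) (hg : IsGammaZero g) {x : H} {v : G}
    (h : IsSaddle f g L x v) : x ∈ argminSet (primalObjective f g L) := by
  intro y
  rw [primalObjective, primalObjective]
  by_cases hy : f y = ⊤
  · rw [hy, EReal.top_add_of_ne_bot (hg.ne_bot _)]; exact le_top
  by_cases hz : g (L y) = ⊤
  · rw [hz, EReal.add_top_of_ne_bot (hf.ne_bot _)]; exact le_top
  have := h.le y (L y) hy hz
  rw [sub_self, inner_zero_left, add_zero] at this
  rw [← hf.coe_toReal h.left_ne_top, ← hg.coe_toReal h.right_ne_top, ← hf.coe_toReal hy,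
    ← hg.coe_toReal hz]
  exact_mod_cast this

theorem le_conjugate {E : Type*} [NormedAddCommGroup E] [InnerProductSpace ℝ E]
    {h : E → EReal} (hh : IsGammaZero h) {x : E} (hx : h x ≠ ⊤) (u : E) :
    ((⟪x, u⟫_ℝ - (h x).toReal : ℝ) : EReal) ≤ conjugate h u := by
  refine le_trans (le_of_eq ?_) (le_iSup _ x)
  rw [EReal.coe_sub, hh.coe_toReal hx]

theorem conjugate_le {E : Type*} [NormedAddCommGroup E] [InnerProductSpace ℝ E]
    {h : E → EReal} (hh : IsGammaZero h) {u : E} {c : ℝ}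
    (hc : ∀ x, h x ≠ ⊤ → ⟪x, u⟫_ℝ - (h x).toReal ≤ c) : conjugate h u ≤ c := by
  refine iSup_le fun x => ?_
  by_cases hx : h x = ⊤
  · rw [hx, EReal.sub_top]; exact bot_le
  · rw [← hh.coe_toReal hx]
    exact_mod_cast hc x hx

/-- Freezing one variable of the saddle inequality at `L x` or `x` bounds each conjugate at `v`. The
sum of the bounds is -f(x) - g(Lx), which by Fenchel–Young is below the dual objective at every `w`.
-/
theorem IsSaddle.mem_argminSet_dual (hf : IsGammaZero f) (hg : IsGammaZero g) {x : H} {v : G}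
    (h : IsSaddle f g L x v) : v ∈ argminSet (dualObjective f g L) := by
  intro w
  rw [dualObjective, dualObjective]
  have hup : conjugate f (-(L.adjoint v)) + conjugate g v ≤
      ((-⟪L x, v⟫_ℝ - (f x).toReal + (⟪L x, v⟫_ℝ - (g (L x)).toReal) : ℝ) : EReal) := by
    rw [EReal.coe_add]
    refine add_le_add (conjugate_le hf fun y hy => ?_) (conjugate_le hg fun z hz => ?_)
    · have := h.le y (L x) hy h.right_ne_top
      rw [inner_neg_right, ContinuousLinearMap.adjoint_inner_right]
      rw [inner_sub_left] at this
      linarith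
    · have := h.le x z h.left_ne_top hz
      rw [inner_sub_left] at this
      linarith
  have hlow : ((-⟪L x, w⟫_ℝ - (f x).toReal + (⟪L x, w⟫_ℝ - (g (L x)).toReal) : ℝ) : EReal) ≤
      conjugate f (-(L.adjoint w)) + conjugate g w := by
    rw [EReal.coe_add]
    refine add_le_add ?_ (le_conjugate hg h.right_ne_top w)
    have := le_conjugate hf h.left_ne_top (-(L.adjoint w))
    rwa [inner_neg_right, ContinuousLinearMap.adjoint_inner_right] at this
  refine (hup.trans (le_of_eq ?_)).trans hlow
  congr 1
  ring

/-- Weak limits of approximate minimizers of the Lagrangian are saddle points. -/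
theorem isSaddle_of_isWeakLimit {ι : Type*} {l : Filter ι} [l.NeBot] (hf : IsGammaZero f)
    (hg : IsGammaZero g) {p : ι → H} {q : ι → G} {a : H} {v : G} (hp : IsWeakLimit l p a)
    (hq : IsWeakLimit l q (L a)) (hfp : ∀ i, f (p i) ≠ ⊤) (hgq : ∀ i, g (q i) ≠ ⊤)
    (happ : ∀ y z, f y ≠ ⊤ → g z ≠ ⊤ → ∃ s : ι → ℝ, Tendsto s l (𝓝 ⟪z - L y, v⟫_ℝ) ∧
      ∀ i, (f (p i)).toReal + (g (q i)).toReal + s i ≤ (f y).toReal + (g z).toReal) :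
    IsSaddle f g L a v := by
  have key : ∀ y z, f y ≠ ⊤ → g z ≠ ⊤ →
      f a + g (L a) ≤ (((f y).toReal + (g z).toReal - ⟪z - L y, v⟫_ℝ : ℝ) : EReal) := by
    intro y z hy hz
    obtain ⟨s, hs, hle⟩ := happ y z hy hz
    -- Finiteness of f(a) and g(La) is not yet known, so lower semicontinuity is applied below
    -- arbitrary smaller levels.
    refine EReal.add_le_of_forall_lt fun c hc d hd => ?_
    have hlim : Tendsto (fun i => (((f y).toReal + (g z).toReal - s i : ℝ) : EReal)) l
        (𝓝 (((f y).toReal + (g z).toReal - ⟪z - L y, v⟫_ℝ : ℝ) : EReal)) :=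
      (continuous_coe_real_ereal.tendsto _).comp (hs.const_sub _)
    refine ge_of_tendsto hlim ?_
    filter_upwards [hf.eventually_lt_of_isWeakLimit hp hc, hg.eventually_lt_of_isWeakLimit hq hd]
      with i hi hi'
    refine (add_le_add hi.le hi'.le).trans ?_
    rw [← hf.coe_toReal (hfp i), ← hg.coe_toReal (hgq i)]
    exact_mod_cast le_sub_iff_add_le.2 (hle i)
  obtain ⟨y₀, hy₀⟩ := hf.exists_ne_top
  obtain ⟨z₀, hz₀⟩ := hg.exists_ne_top
  have hlt := (key y₀ z₀ hy₀ hz₀).trans_lt (EReal.coe_lt_top _)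
  have hfa : f a ≠ ⊤ := by
    intro h
    rw [h, EReal.top_add_of_ne_bot (hg.ne_bot _)] at hlt
    exact lt_irrefl _ hlt
  have hga : g (L a) ≠ ⊤ := by
    intro h
    rw [h, EReal.add_top_of_ne_bot (hf.ne_bot _)] at hlt
    exact lt_irrefl _ hlt
  refine ⟨hfa, hga, fun y z hy hz => ?_⟩
  have h := key y z hy hz
  rw [← hf.coe_toReal hfa, ← hg.coe_toReal hga] at h
  have h' : (f a).toReal + (g (L a)).toReal ≤
    (f y).toReal + (g z).toReal - ⟪z - L y, v⟫_ℝ := by exact_mod_cast h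
  linarith

end Saddle

/-! ### Descent inequality and Opial's argument -/

section Algorithm

variable {H G : Type*} [NormedAddCommGroup H] [InnerProductSpace ℝ H] [CompleteSpace H]
  [NormedAddCommGroup G] [InnerProductSpace ℝ G] [CompleteSpace G]

/-- With `norm_map_sub_sq_le`, this bounds the squared norm of the skew operator by 1 + ‖L‖². -/
theorem norm_adjoint_sq_add_le (L : H →L[ℝ] G) (r : G) :
    ‖L.adjoint r‖ ^ 2 + ‖r‖ ^ 2 ≤ (1 + ‖L‖ ^ 2) * ‖r‖ ^ 2 := by
  have h : ‖L.adjoint r‖ ≤ ‖L‖ * ‖r‖ := by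
    simpa using L.adjoint.le_opNorm r
  nlinarith [pow_le_pow_left₀ (norm_nonneg _) h 2]

theorem norm_map_sub_sq_le {H G : Type*} [NormedAddCommGroup H] [InnerProductSpace ℝ H]
    [NormedAddCommGroup G] [InnerProductSpace ℝ G] (L : H →L[ℝ] G) (d : H) (e : G) :
    ‖L d - e‖ ^ 2 ≤ (1 + ‖L‖ ^ 2) * (‖d‖ ^ 2 + ‖e‖ ^ 2) := by
  have h : ‖L d - e‖ ≤ ‖L‖ * ‖d‖ + ‖e‖ :=
    (norm_sub_le _ _).trans (add_le_add_left (L.le_opNorm d) _)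
  nlinarith [pow_le_pow_left₀ (norm_nonneg _) h 2, sq_nonneg (‖L‖ * ‖e‖ - ‖d‖)]

/-- One step of the forward-backward-forward iteration, in terms of the displacements
`X`, `Y`, `V` from a saddle point and of the residuals `d`, `e`. -/
theorem forward_backward_forward_descent (L : H →L[ℝ] G) {γ κ : ℝ}
    (hκ : γ ^ 2 * (1 + ‖L‖ ^ 2) ≤ κ) (X d : H) (Y e V r : G) (hr : r = γ • (L X - Y))
    (hmono : ‖d‖ ^ 2 - ⟪X, d⟫_ℝ + ‖e‖ ^ 2 - ⟪Y, e⟫_ℝ + ⟪r - γ • (L d - e), V⟫_ℝ ≤ 0) :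
    ‖X - (d + γ • L.adjoint r)‖ ^ 2 + ‖Y - (e - γ • r)‖ ^ 2 + ‖V + (r - γ • (L d - e))‖ ^ 2
      + (1 - κ) * (‖d‖ ^ 2 + ‖e‖ ^ 2 + ‖r‖ ^ 2) ≤ ‖X‖ ^ 2 + ‖Y‖ ^ 2 + ‖V‖ ^ 2 := by
  have hB : γ ^ 2 * (‖L.adjoint r‖ ^ 2 + ‖r‖ ^ 2 + ‖L d - e‖ ^ 2) ≤
      κ * (‖d‖ ^ 2 + ‖e‖ ^ 2 + ‖r‖ ^ 2) := by
    have h := add_le_add (norm_adjoint_sq_add_le L r) (norm_map_sub_sq_le L d e)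
    have h2 := mul_le_mul_of_nonneg_left h (sq_nonneg γ)
    have h3 := mul_le_mul_of_nonneg_right hκ
      (by positivity : 0 ≤ ‖d‖ ^ 2 + ‖e‖ ^ 2 + ‖r‖ ^ 2)
    linarith
  -- The definition of `r` turns the remaining cross term into ‖r‖². In the sum of `e1`, `e2`, `e3`,
  -- the products of `r` with `L d` and `e` cancel by skewness.
  have hrr : γ * (⟪L X, r⟫_ℝ - ⟪Y, r⟫_ℝ) = ‖r‖ ^ 2 := by
    rw [← inner_sub_left, ← real_inner_smul_left, ← hr, real_inner_self_eq_norm_sq]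
  have e1 : ‖X - (d + γ • L.adjoint r)‖ ^ 2 = ‖X‖ ^ 2 - 2 * (⟪X, d⟫_ℝ + γ * ⟪L X, r⟫_ℝ)
      + (‖d‖ ^ 2 + 2 * (γ * ⟪L d, r⟫_ℝ) + γ ^ 2 * ‖L.adjoint r‖ ^ 2) := by
    rw [norm_sub_sq_real, norm_add_sq_real, inner_add_right, inner_smul_right, inner_smul_right,
      L.adjoint_inner_right, L.adjoint_inner_right, norm_smul, mul_pow, Real.norm_eq_abs, sq_abs]
  have e2 : ‖Y - (e - γ • r)‖ ^ 2 = ‖Y‖ ^ 2 - 2 * (⟪Y, e⟫_ℝ - γ * ⟪Y, r⟫_ℝ)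
      + (‖e‖ ^ 2 - 2 * (γ * ⟪e, r⟫_ℝ) + γ ^ 2 * ‖r‖ ^ 2) := by
    rw [norm_sub_sq_real, norm_sub_sq_real, inner_sub_right, inner_smul_right, inner_smul_right,
      norm_smul, mul_pow, Real.norm_eq_abs, sq_abs]
  have e3 : ‖V + (r - γ • (L d - e))‖ ^ 2 = ‖V‖ ^ 2 + 2 * ⟪r - γ • (L d - e), V⟫_ℝ
      + (‖r‖ ^ 2 - 2 * (γ * (⟪L d, r⟫_ℝ - ⟪e, r⟫_ℝ)) + γ ^ 2 * ‖L d - e‖ ^ 2) := by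
    rw [norm_add_sq_real, norm_sub_sq_real r, real_inner_comm V, inner_smul_right,
      real_inner_comm (L d - e) r, inner_sub_left,
      norm_smul, mul_pow, Real.norm_eq_abs, sq_abs]
  rw [e1, e2, e3]
  linarith

variable {f : H → EReal} {g : G → EReal} {L : H →L[ℝ] G}

/-- The Lyapunov function of the iteration at a reference point `(a, La, c)`. -/
def lyapunov {H G : Type*} [NormedAddCommGroup H] [InnerProductSpace ℝ H]
    [NormedAddCommGroup G] [InnerProductSpace ℝ G] (L : H →L[ℝ] G) (x : H) (y v : G) (a : H) (c : G) : ℝ :=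
  ‖x - a‖ ^ 2 + ‖y - L a‖ ^ 2 + ‖v - c‖ ^ 2

/-- The squared distances to a saddle point decrease along the iteration. -/
theorem IsSaddle.lyapunov_step {γ κ : ℝ} (hγ : 0 < γ)
    (hκ : γ ^ 2 * (1 + ‖L‖ ^ 2) ≤ κ) {a : H} {c : G} (hs : IsSaddle f g L a c)
    {x p : H} {y v q r : G} (hr : r = γ • (L x - y)) (hp : f p ≠ ⊤) (hq : g q ≠ ⊤)
    (hfp : ∀ z, f z ≠ ⊤ →
      ⟪z - p, γ⁻¹ • (x - γ • L.adjoint v - p)⟫_ℝ + (f p).toReal ≤ (f z).toReal)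
    (hgq : ∀ z, g z ≠ ⊤ → ⟪z - q, γ⁻¹ • (y + γ • v - q)⟫_ℝ + (g q).toReal ≤ (g z).toReal) :
    lyapunov L (p - γ • L.adjoint r) (q + γ • r) (v + γ • (L p - q)) a c
      + (1 - κ) * (‖x - p‖ ^ 2 + ‖y - q‖ ^ 2 + ‖r‖ ^ 2) ≤ lyapunov L x y v a c := by
  have hr' : r = γ • (L (x - a) - (y - L a)) := by
    rw [hr, map_sub, sub_sub_sub_cancel_right]
  have hγr : γ • (L p - q) = r - γ • (L (x - p) - (y - q)) := by
    rw [hr, map_sub]; module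
  have h1 := hfp a hs.left_ne_top
  have h2 := hgq (L a) hs.right_ne_top
  have h3 := hs.le p q hp hq
  have i1 : ⟪a - p, γ⁻¹ • (x - γ • L.adjoint v - p)⟫_ℝ =
      γ⁻¹ * (‖x - p‖ ^ 2 - ⟪x - a, x - p⟫_ℝ) - ⟪L a - L p, v⟫_ℝ := by
    have e : x - γ • L.adjoint v - p = (x - p) - γ • L.adjoint v := by abel
    have e' : a - p = (x - p) - (x - a) := by abel
    rw [e, smul_sub, smul_smul, inv_mul_cancel₀ hγ.ne', one_smul, inner_sub_right,
      L.adjoint_inner_right, inner_smul_right, map_sub]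
    nth_rewrite 1 [e']
    rw [inner_sub_left, real_inner_self_eq_norm_sq]
  have i2 : ⟪L a - q, γ⁻¹ • (y + γ • v - q)⟫_ℝ =
      γ⁻¹ * (‖y - q‖ ^ 2 - ⟪y - L a, y - q⟫_ℝ) + ⟪L a - q, v⟫_ℝ := by
    have e : y + γ • v - q = (y - q) + γ • v := by abel
    have e' : L a - q = (y - q) - (y - L a) := by abel
    rw [e, smul_add, smul_smul, inv_mul_cancel₀ hγ.ne', one_smul, inner_add_right,
      inner_smul_right]
    nth_rewrite 1 [e']
    rw [inner_sub_left, real_inner_self_eq_norm_sq]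
  have hmono : ‖x - p‖ ^ 2 - ⟪x - a, x - p⟫_ℝ + ‖y - q‖ ^ 2 - ⟪y - L a, y - q⟫_ℝ
      + ⟪r - γ • (L (x - p) - (y - q)), v - c⟫_ℝ ≤ 0 := by
    rw [i1] at h1
    rw [i2] at h2
    -- Function values cancel on adding the proximal inequalities at `a` and `L a` to the saddle
    -- inequality at `(p, q)`.
    have hsum : γ⁻¹ * (‖x - p‖ ^ 2 - ⟪x - a, x - p⟫_ℝ + (‖y - q‖ ^ 2 - ⟪y - L a, y - q⟫_ℝ))
        + ⟪L p - q, v - c⟫_ℝ ≤ 0 := by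
      simp only [inner_sub_left, inner_sub_right] at h1 h2 h3 ⊢
      linarith
    rw [← hγr, real_inner_smul_left]
    have := mul_le_mul_of_nonneg_left hsum hγ.le
    rw [mul_add, mul_inv_cancel_left₀ hγ.ne'] at this
    linarith
  have h := forward_backward_forward_descent L hκ (x - a) (x - p) (y - L a) (y - q) (v - c) r
    hr' hmono
  have e1 : x - a - (x - p + γ • L.adjoint r) = p - γ • L.adjoint r - a := by abel
  have e2 : y - L a - (y - q - γ • r) = q + γ • r - L a := by abel
  have e3 : v - c + (r - γ • (L (x - p) - (y - q))) = v + γ • (L p - q) - c := by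
    rw [hγr]; abel
  rw [e1, e2, e3] at h
  exact h

/-- Opial's argument: if the Lyapunov functions converge at all reference points of a set which
contains all weak limits along ultrafilters, then the sequence converges weakly. -/
theorem exists_isWeakLimit_of_lyapunov {H G : Type*} [NormedAddCommGroup H]
    [InnerProductSpace ℝ H] [NormedAddCommGroup G] [InnerProductSpace ℝ G] {L : H →L[ℝ] G} {S : H → G → Prop} {x : ℕ → H} {y v : ℕ → G}
    (hlim : ∀ a c, S a c → ∃ t, Tendsto (fun n => lyapunov L (x n) (y n) (v n) a c) atTop (𝓝 t))
    (hcluster : ∀ U : Ultrafilter ℕ, (U : Filter ℕ) ≤ atTop → ∃ a c, S a c ∧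
      IsWeakLimit (U : Filter ℕ) x a ∧ IsWeakLimit (U : Filter ℕ) y (L a) ∧
      IsWeakLimit (U : Filter ℕ) v c) :
    ∃ a c, S a c ∧ IsWeakLimit atTop x a ∧ IsWeakLimit atTop v c := by
  obtain ⟨a, c, hS, hxa, hya, hvc⟩ := hcluster (Ultrafilter.of atTop) (Ultrafilter.of_le atTop)
  have huniq : ∀ U : Ultrafilter ℕ, (U : Filter ℕ) ≤ atTop →
      IsWeakLimit (U : Filter ℕ) x a ∧ IsWeakLimit (U : Filter ℕ) v c := by
    intro U hU
    obtain ⟨a', c', hS', hxa', hya', hvc'⟩ := hcluster U hU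
    obtain ⟨t, ht⟩ := hlim a c hS
    obtain ⟨t', ht'⟩ := hlim a' c' hS'
    -- Up to a constant, `P` is half a difference of two Lyapunov functions: the quadratic terms
    -- cancel. So `P` converges along `atTop`, and both ultrafilters must give the same limit.
    set P : ℕ → ℝ := fun n => ⟪x n, a - a'⟫_ℝ + ⟪y n, L a - L a'⟫_ℝ + ⟪v n, c - c'⟫_ℝ with hP
    have hPlim : ∃ s, Tendsto P atTop (𝓝 s) := by
      refine ⟨_, ((ht'.sub ht).add_const (‖a‖ ^ 2 + ‖L a‖ ^ 2 + ‖c‖ ^ 2 -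
        (‖a'‖ ^ 2 + ‖L a'‖ ^ 2 + ‖c'‖ ^ 2))).const_mul (1 / 2) |>.congr fun n => ?_⟩
      simp only [hP, lyapunov, norm_sub_sq_real, inner_sub_right]
      ring
    obtain ⟨s, hs⟩ := hPlim
    have h1 := tendsto_nhds_unique (hs.mono_left (Ultrafilter.of_le atTop))
      (((hxa (a - a')).add (hya (L a - L a'))).add (hvc (c - c')))
    have h2 := tendsto_nhds_unique (hs.mono_left hU)
      (((hxa' (a - a')).add (hya' (L a - L a'))).add (hvc' (c - c')))
    have h3 : ‖a - a'‖ ^ 2 + ‖L a - L a'‖ ^ 2 + ‖c - c'‖ ^ 2 = 0 := by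
      simp only [← real_inner_self_eq_norm_sq]
      nth_rewrite 1 [inner_sub_left]
      nth_rewrite 1 [inner_sub_left]
      nth_rewrite 1 [inner_sub_left]
      linarith
    have ha : a = a' := by
      rw [← sub_eq_zero, ← norm_eq_zero, ← sq_eq_zero_iff]
      nlinarith [sq_nonneg ‖a - a'‖, sq_nonneg ‖L a - L a'‖, sq_nonneg ‖c - c'‖]
    have hc : c = c' := by
      rw [← sub_eq_zero, ← norm_eq_zero, ← sq_eq_zero_iff]
      nlinarith [sq_nonneg ‖a - a'‖, sq_nonneg ‖L a - L a'‖, sq_nonneg ‖c - c'‖]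
    rw [ha, hc]
    exact ⟨hxa', hvc'⟩
  exact ⟨a, c, hS, fun u => tendsto_iff_ultrafilter _ _ _ |>.2 fun U hU => (huniq U hU).1 u,
    fun u => tendsto_iff_ultrafilter _ _ _ |>.2 fun U hU => (huniq U hU).2 u⟩

theorem tendsto_zero_of_sq_le {E : Type*} [NormedAddCommGroup E] {d : ℕ → E} {b : ℕ → ℝ}
    (h : ∀ n, ‖d n‖ ^ 2 ≤ b n) (hb : Tendsto b atTop (𝓝 0)) : Tendsto d atTop (𝓝 0) := by
  have h2 : Tendsto (fun n => ‖d n‖ ^ 2) atTop (𝓝 0) :=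
    squeeze_zero (fun n => sq_nonneg _) h hb
  rw [tendsto_zero_iff_norm_tendsto_zero]
  simpa using h2.sqrt

theorem norm_le_sqrt_add {E : Type*} [NormedAddCommGroup E] {z b : E} {M : ℝ}
    (h : ‖z - b‖ ^ 2 ≤ M) : ‖z‖ ≤ √M + ‖b‖ := by
  linarith [norm_sub_norm_le z b, Real.le_sqrt_of_sq_le h]

theorem tendsto_inv_smul_zero {E : Type*} [NormedAddCommGroup E] [NormedSpace ℝ E] {d : ℕ → E}
    {γ : ℕ → ℝ} {ε : ℝ} (hε : 0 < ε) (hγ : ∀ n, ε ≤ γ n) (hd : Tendsto d atTop (𝓝 0)) :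
    Tendsto (fun n => (γ n)⁻¹ • d n) atTop (𝓝 0) := by
  refine squeeze_zero_norm (a := fun n => ε⁻¹ * ‖d n‖) (fun n => ?_) ?_
  · rw [norm_smul, norm_inv, Real.norm_of_nonneg (hε.le.trans (hγ n))]
    exact mul_le_mul_of_nonneg_right (inv_anti₀ hε (hγ n)) (norm_nonneg _)
  · simpa using hd.norm.const_mul ε⁻¹

end Algorithm

end ConvexDuality

/-! ### Weak convergence of the iteration -/

open ConvexDuality
theorem proposition4
    {H : Type*} [NormedAddCommGroup H] [InnerProductSpace ℝ H] [CompleteSpace H]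
    {G : Type*} [NormedAddCommGroup G] [InnerProductSpace ℝ G] [CompleteSpace G]
    (f : H → EReal) (hf : IsGammaZero f)
    (g : G → EReal) (hg : IsGammaZero g)
    (L : H →L[ℝ] G) (hL : L ≠ 0)
    (hran : (0 : H) ∈ setValuedRange (primalOperator f g L))
    (ε : ℝ) (hε : 0 < ε)
    (γ : ℕ → ℝ) (hγ : ∀ n, ε ≤ γ n ∧ γ n ≤ (1 - ε) / √(1 + ‖L‖ ^ 2))
    (x : ℕ → H) (y : ℕ → G) (v : ℕ → G)
    (r : ℕ → G) (p : ℕ → H) (q : ℕ → G)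
    (hr : ∀ n, r n = γ n • (L (x n) - y n))
    (hp : ∀ n, p n = prox (scale (γ n) f) (x n - γ n • L.adjoint (v n)))
    (hq : ∀ n, q n = prox (scale (γ n) g) (y n + γ n • v n))
    (hx : ∀ n, x (n + 1) = p n - γ n • L.adjoint (r n))
    (hy : ∀ n, y (n + 1) = q n + γ n • r n)
    (hv : ∀ n, v (n + 1) = v n + γ n • (L (p n) - q n)) :
    (∃ xbar ∈ argminSet (primalObjective f g L), WeaklyConvergesTo x xbar) ∧
      (∃ vbar ∈ argminSet (dualObjective f g L), WeaklyConvergesTo v vbar) := by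
  have hγpos : ∀ n, 0 < γ n := fun n => hε.trans_le (hγ n).1
  have hsqrt : 0 < √(1 + ‖L‖ ^ 2) := Real.sqrt_pos.2 (by positivity)
  have hγsqrt : ∀ n, γ n * √(1 + ‖L‖ ^ 2) ≤ 1 - ε := fun n => (le_div_iff₀ hsqrt).1 (hγ n).2
  have hε1 : ε < 1 := by
    have := mul_pos (hγpos 0) hsqrt
    linarith [hγsqrt 0]
  have hκ : ∀ n, γ n ^ 2 * (1 + ‖L‖ ^ 2) ≤ (1 - ε) ^ 2 := fun n => by
    have h := pow_le_pow_left₀ (mul_pos (hγpos n) hsqrt).le (hγsqrt n) 2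
    rwa [mul_pow, Real.sq_sqrt (by positivity)] at h
  have hκ1 : 0 < 1 - (1 - ε) ^ 2 := by nlinarith
  have hprox : ∀ n, f (p n) ≠ ⊤ ∧ ∀ z, f z ≠ ⊤ →
      ⟪z - p n, (γ n)⁻¹ • (x n - γ n • L.adjoint (v n) - p n)⟫_ℝ + (f (p n)).toReal
        ≤ (f z).toReal := fun n => by
    rw [hp n]; exact hf.prox_scale_spec (hγpos n) _
  have hprox' : ∀ n, g (q n) ≠ ⊤ ∧ ∀ z, g z ≠ ⊤ →
      ⟪z - q n, (γ n)⁻¹ • (y n + γ n • v n - q n)⟫_ℝ + (g (q n)).toReal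
        ≤ (g z).toReal := fun n => by
    rw [hq n]; exact hg.prox_scale_spec (hγpos n) _
  have hstep : ∀ a c, IsSaddle f g L a c → ∀ n,
      lyapunov L (x (n + 1)) (y (n + 1)) (v (n + 1)) a c
        + (1 - (1 - ε) ^ 2) * (‖x n - p n‖ ^ 2 + ‖y n - q n‖ ^ 2 + ‖r n‖ ^ 2)
        ≤ lyapunov L (x n) (y n) (v n) a c := by
    intro a c hs n
    rw [hx, hy, hv]
    exact hs.lyapunov_step (hγpos n) (hκ n) (hr n) (hprox n).1 (hprox' n).1 (hprox n).2
      (hprox' n).2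
  have hanti : ∀ a c, IsSaddle f g L a c →
      Antitone fun n => lyapunov L (x n) (y n) (v n) a c := by
    intro a c hs
    refine antitone_nat_of_succ_le fun n => le_trans ?_ (hstep a c hs n)
    exact le_add_of_nonneg_right (by positivity)
  have hlim : ∀ a c, IsSaddle f g L a c →
      ∃ t, Tendsto (fun n => lyapunov L (x n) (y n) (v n) a c) atTop (𝓝 t) := fun a c hs =>
    ⟨_, tendsto_atTop_ciInf (hanti a c hs)
      ⟨0, by rintro _ ⟨n, rfl⟩; simp only [lyapunov]; positivity⟩⟩
  obtain ⟨a₀, c₀, hs₀⟩ := exists_isSaddle hf hg hran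
  obtain ⟨t, ht⟩ := hlim a₀ c₀ hs₀
  -- Consecutive differences of a convergent sequence vanish, so the residuals do too.
  have hb : Tendsto (fun n => (1 - (1 - ε) ^ 2)⁻¹ * (lyapunov L (x n) (y n) (v n) a₀ c₀ -
      lyapunov L (x (n + 1)) (y (n + 1)) (v (n + 1)) a₀ c₀)) atTop (𝓝 0) := by
    simpa using (ht.sub ((tendsto_add_atTop_iff_nat 1).2 ht)).const_mul (1 - (1 - ε) ^ 2)⁻¹
  have hres : ∀ n, ‖x n - p n‖ ^ 2 + ‖y n - q n‖ ^ 2 + ‖r n‖ ^ 2 ≤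
      (1 - (1 - ε) ^ 2)⁻¹ * (lyapunov L (x n) (y n) (v n) a₀ c₀ -
      lyapunov L (x (n + 1)) (y (n + 1)) (v (n + 1)) a₀ c₀) := fun n => by
    rw [le_inv_mul_iff₀ hκ1]
    linarith [hstep a₀ c₀ hs₀ n]
  have hd : Tendsto (fun n => x n - p n) atTop (𝓝 0) := tendsto_zero_of_sq_le (fun n => by
    have := hres n
    nlinarith [sq_nonneg ‖y n - q n‖, sq_nonneg ‖r n‖]) hb
  have he : Tendsto (fun n => y n - q n) atTop (𝓝 0) := tendsto_zero_of_sq_le (fun n => by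
    have := hres n
    nlinarith [sq_nonneg ‖x n - p n‖, sq_nonneg ‖r n‖]) hb
  have hr0 : Tendsto r atTop (𝓝 0) := tendsto_zero_of_sq_le (fun n => by
    have := hres n
    nlinarith [sq_nonneg ‖x n - p n‖, sq_nonneg ‖y n - q n‖]) hb
  -- The lower bound `ε` on the step sizes allows division of `r n` by `γ n`.
  have hLxy : Tendsto (fun n => L (x n) - y n) atTop (𝓝 0) := by
    refine (tendsto_inv_smul_zero hε (fun n => (hγ n).1) hr0).congr fun n => ?_
    rw [hr, inv_smul_smul₀ (hγpos n).ne']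
  have hLpq : Tendsto (fun n => L (p n) - q n) atTop (𝓝 0) := by
    have hLd : Tendsto (fun n => L (x n - p n)) atTop (𝓝 0) := by
      simpa only [map_zero, Function.comp_def] using (L.continuous.tendsto 0).comp hd
    have h := (hLxy.sub hLd).add he
    rw [sub_zero, add_zero] at h
    refine h.congr fun n => ?_
    rw [map_sub]; abel
  set M := lyapunov L (x 0) (y 0) (v 0) a₀ c₀
  have hM : ∀ n, ‖x n - a₀‖ ^ 2 + ‖y n - L a₀‖ ^ 2 + ‖v n - c₀‖ ^ 2 ≤ M :=
    fun n => hanti a₀ c₀ hs₀ n.zero_le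
  have hxb : ∀ n, ‖x n‖ ≤ √M + ‖a₀‖ := fun n => norm_le_sqrt_add (by
    linarith [hM n, sq_nonneg ‖y n - L a₀‖, sq_nonneg ‖v n - c₀‖])
  have hyb : ∀ n, ‖y n‖ ≤ √M + ‖L a₀‖ := fun n => norm_le_sqrt_add (by
    linarith [hM n, sq_nonneg ‖x n - a₀‖, sq_nonneg ‖v n - c₀‖])
  have hvb : ∀ n, ‖v n‖ ≤ √M + ‖c₀‖ := fun n => norm_le_sqrt_add (by
    linarith [hM n, sq_nonneg ‖y n - L a₀‖, sq_nonneg ‖x n - a₀‖])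
  obtain ⟨B, hB⟩ := (Metric.isBounded_range_of_tendsto _ hd).exists_norm_le
  obtain ⟨B', hB'⟩ := (Metric.isBounded_range_of_tendsto _ he).exists_norm_le
  have hpb : ∀ z n, ‖z - p n‖ ≤ ‖z‖ + (B + (√M + ‖a₀‖)) := fun z n => by
    have e : z - p n = z + ((x n - p n) - x n) := by abel
    rw [e]
    exact (norm_add_le _ _).trans (add_le_add_right ((norm_sub_le _ _).trans
      (add_le_add (hB _ ⟨n, rfl⟩) (hxb n))) _)
  have hqb : ∀ z n, ‖z - q n‖ ≤ ‖z‖ + (B' + (√M + ‖L a₀‖)) := fun z n => by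
    have e : z - q n = z + ((y n - q n) - y n) := by abel
    rw [e]
    exact (norm_add_le _ _).trans (add_le_add_right ((norm_sub_le _ _).trans
      (add_le_add (hB' _ ⟨n, rfl⟩) (hyb n))) _)
  have hcluster : ∀ U : Ultrafilter ℕ, (U : Filter ℕ) ≤ atTop → ∃ a c, IsSaddle f g L a c ∧
      IsWeakLimit (U : Filter ℕ) x a ∧ IsWeakLimit (U : Filter ℕ) y (L a) ∧
      IsWeakLimit (U : Filter ℕ) v c := by
    intro U hU
    obtain ⟨a, ha⟩ := exists_isWeakLimit U hxb
    obtain ⟨c, hc⟩ := exists_isWeakLimit U hvb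
    have hya : IsWeakLimit (U : Filter ℕ) y (L a) := by
      simpa using (ha.map L).sub (isWeakLimit_of_tendsto (hLxy.mono_left hU))
    have hpa : IsWeakLimit (U : Filter ℕ) p a := by
      simpa using ha.sub (isWeakLimit_of_tendsto (hd.mono_left hU))
    have hqa : IsWeakLimit (U : Filter ℕ) q (L a) := by
      simpa using hya.sub (isWeakLimit_of_tendsto (he.mono_left hU))
    refine ⟨a, c, isSaddle_of_isWeakLimit hf hg hpa hqa (fun n => (hprox n).1)
      (fun n => (hprox' n).1) fun z w hz hw => ?_, ha, hya, hc⟩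
    -- The sum of the two proximal inequalities at `z` and `w`. The first term converges by weak
    -- convergence of `v`; the others pair bounded sequences with null sequences.
    refine ⟨fun n => ⟪v n, w - L z⟫_ℝ + ⟪z - p n, (γ n)⁻¹ • (x n - p n)⟫_ℝ
      + ⟪w - q n, (γ n)⁻¹ • (y n - q n)⟫_ℝ + ⟪v n, L (p n) - q n⟫_ℝ, ?_, fun n => ?_⟩
    · have h1 := tendsto_inner_zero_of_bounded (hpb z)
        (tendsto_inv_smul_zero hε (fun n => (hγ n).1) hd)
      have h2 := tendsto_inner_zero_of_bounded (hqb w)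
        (tendsto_inv_smul_zero hε (fun n => (hγ n).1) he)
      have h3 := tendsto_inner_zero_of_bounded hvb hLpq
      have h := (((hc (w - L z)).add (h1.mono_left hU)).add (h2.mono_left hU)).add
        (h3.mono_left hU)
      rwa [add_zero, add_zero, add_zero, real_inner_comm] at h
    · have h1 := (hprox n).2 z hz
      have h2 := (hprox' n).2 w hw
      have e1 : (γ n)⁻¹ • (x n - γ n • L.adjoint (v n) - p n) =
          (γ n)⁻¹ • (x n - p n) - L.adjoint (v n) := by
        rw [sub_right_comm, smul_sub, inv_smul_smul₀ (hγpos n).ne']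
      have e2 : (γ n)⁻¹ • (y n + γ n • v n - q n) = (γ n)⁻¹ • (y n - q n) + v n := by
        rw [add_sub_right_comm, smul_add, inv_smul_smul₀ (hγpos n).ne']
      rw [e1, inner_sub_right, L.adjoint_inner_right, map_sub, inner_sub_left _ _ (v n)] at h1
      rw [e2, inner_add_right, inner_sub_left _ _ (v n)] at h2
      beta_reduce
      rw [inner_sub_right (v n), inner_sub_right (v n), real_inner_comm w (v n),
        real_inner_comm (L z) (v n), real_inner_comm (L (p n)) (v n), real_inner_comm (q n) (v n)]
      linarith
  obtain ⟨a, c, hs, hxa, hvc⟩ := exists_isWeakLimit_of_lyapunov hlim hcluster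
  exact ⟨⟨a, hs.mem_argminSet_primal hf hg, weaklyConvergesTo_of_isWeakLimit hxa⟩,
    ⟨c, hs.mem_argminSet_dual hf hg, weaklyConvergesTo_of_isWeakLimit hvc⟩⟩
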